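/- Let $\mathrm{Sym}_0(3)$ be the space of symmetric traceless real $3\times 3$ matrices, with norm $|Q|^2=\sum_{i,j}Q_{ij}^2$, and let $v_{\min}(Q)$ denote the smallest eigenvalue of $Q$. Let $\mathcal{Q}=\{Q\in\mathrm{Sym}_0(3): v_{\min}(Q)>-\tfrac13\}$ be the set of physical Q-tensors. Let $dp$ be the two-dimensional Hausdorff measure on the unit sphere $\mathbb{S}^2\subset\mathbb{R}^3$ and $\mathcal{P}(\mathbb{S}^2)=\{f\in L^1(\mathbb{S}^2): f\ge 0\text{ a.e.},\ \int_{\mathbb{S}^2} f\,dp=1\}$. For $\eta\in\mathbb{R}$ and $f\in\mathcal{P}(\mathbb{S}^2)$ put $$\mathcal{F}(f)=\int_{\mathbb{S}^2} f(p)\ln f(p)-f(p)\ln\Big(\int_{\mathbb{S}^2}\big((p\cdot q)^2-\tfrac13\big)f(q)\,dq-\eta\Big)\,dp,$$ where $-\ln$ is extended by $+\infty$ to non-positive arguments and $0\ln 0=0\cdot(+\infty)=0$. For $Q\in\mathrm{Sym}_0(3)$ let $$J(Q)=\inf\Big\{\mathcal{F}(f): f\in\mathcal{P}(\mathbb{S}^2),\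 \int_{\mathbb{S}^2}\big(p\otimes p-\tfrac13 I\big)f(p)\,dp=Q\Big\},$$ with $\inf\emptyset=+\infty$. **Proposition.** For every $\eta\in\mathbb{R}$, $J$ takes values in $\mathbb{R}\cup\{+\infty\}$, and its effective domain $\mathrm{dom}(J)=\{Q\in\mathrm{Sym}_0(3): J(Q)<+\infty\}$ is $$\mathrm{dom}(J)=\mathcal{Q}\cap\{Q\in\mathrm{Sym}_0(3): |Q|^2>\eta\}.$$ In particular, $\mathrm{dom}(J)$ is open in $\mathrm{Sym}_0(3)$. -/

import Mathlib

open MeasureTheory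

namespace QTensorModel

noncomputable section

/-- Three-dimensional Euclidean space. -/
abbrev R3 : Type := EuclideanSpace ℝ (Fin 3)

/-- The unit sphere of `ℝ³`. -/
abbrev S2 : Type := Metric.sphere (0 : R3) 1

/-- The 2-dimensional Hausdorff measure on the unit sphere, normalised so that it agrees with
Lebesgue measure on planes (so the sphere has total mass `4π`). -/
def surf : Measure S2 := Measure.euclideanHausdorffMeasure 2

/-- The real vector space of symmetric traceless `3 × 3` matrices, with the topology inherited from
the space of all matrices. -/
def Sym0 : Submodule ℝ (Matrix (Fin 3) (Fin 3) ℝ) where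
  carrier := {Q | Q.IsSymm ∧ Q.trace = 0}
  add_mem' := by
    rintro A B ⟨hA, hA'⟩ ⟨hB, hB'⟩
    exact ⟨hA.add hB, by rw [Matrix.trace_add, hA', hB', add_zero]⟩
  zero_mem' := ⟨Matrix.isSymm_zero, Matrix.trace_zero _ _⟩
  smul_mem' := by
    rintro c A ⟨hA, hA'⟩
    exact ⟨hA.smul c, by rw [Matrix.trace_smul, hA', smul_zero]⟩

theorem Sym0.isHermitian (Q : Sym0) : (Q : Matrix (Fin 3) (Fin 3) ℝ).IsHermitian := by
  have h : (Q : Matrix (Fin 3) (Fin 3) ℝ).IsSymm := Q.2.1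
  rw [Matrix.IsHermitian, Matrix.conjTranspose_eq_transpose_of_trivial]
  exact h

/-- The smallest eigenvalue of a symmetric traceless matrix. -/
def vMin (Q : Sym0) : ℝ := ⨅ i : Fin 3, (Sym0.isHermitian Q).eigenvalues i

/-- The squared Frobenius norm `|Q|² = Q · Q`. -/
def normSq (Q : Sym0) : ℝ := ∑ i : Fin 3, ∑ j : Fin 3, (Q : Matrix (Fin 3) (Fin 3) ℝ) i j ^ 2

/-- The set of physical Q-tensors. -/
def physical : Set Sym0 := {Q | -(1 / 3) < vMin Q}

/-- The probability densities on the sphere. -/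
def densities : Set (S2 → ℝ) :=
  {f | Integrable f surf ∧ 0 ≤ᵐ[surf] f ∧ ∫ p, f p ∂surf = 1}

/-- The Q-tensor `∫ (p ⊗ p - I/3) f(p) dp` of a density, computed entrywise. -/
def qTensor (f : S2 → ℝ) : Matrix (Fin 3) (Fin 3) ℝ :=
  Matrix.of fun i j =>
    ∫ p : S2, ((p : R3) i * (p : R3) j - (1 / 3) * (1 : Matrix (Fin 3) (Fin 3) ℝ) i j) * f p ∂surf

/-- `-ln`, extended by `+∞` to non-positive arguments. -/
def negLog (x : ℝ) : EReal := if 0 < x then ((-Real.log x : ℝ) : EReal) else ⊤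

/-- The integral of an extended-real-valued function: the integral of its positive part minus the
integral of its negative part (meaningful when at most one of the two is infinite). -/
def extIntegral {X : Type*} [MeasurableSpace X] (μ : Measure X) (g : X → EReal) : EReal :=
  ((∫⁻ x, (g x).toENNReal ∂μ : ENNReal) : EReal) - ((∫⁻ x, (-g x).toENNReal ∂μ : ENNReal) : EReal)

/-- The effective field `∫ ((p · q)² - 1/3) f(q) dq - η`. -/
def field (η : ℝ) (f : S2 → ℝ) (p : S2) : ℝ :=
  (∫ q : S2, ((inner ℝ (p : R3) (q : R3)) ^ 2 - 1 / 3) * f q ∂surf) - η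

/-- The free energy `∫ f ln f - f ln (field) dp`. In `EReal`, `0 * ⊤ = 0`, as in the usual
convention, and `Real.log 0 = 0` gives `0 ln 0 = 0`. -/
def energy (η : ℝ) (f : S2 → ℝ) : EReal :=
  extIntegral surf fun p =>
    ((f p * Real.log (f p) : ℝ) : EReal) + ((f p : ℝ) : EReal) * negLog (field η f p)

/-- The densities with prescribed Q-tensor. -/
def admissible (Q : Sym0) : Set (S2 → ℝ) :=
  {f | f ∈ densities ∧ qTensor f = (Q : Matrix (Fin 3) (Fin 3) ℝ)}

/-- The macroscopic function: the infimum of the energy over the densities with Q-tensor `Q`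
(`+∞` if there are none). -/
def J (η : ℝ) (Q : Sym0) : EReal := ⨅ f ∈ admissible Q, energy η f

/-- The effective domain of the macroscopic function. -/
def domJ (η : ℝ) : Set Sym0 := {Q | J η Q < ⊤}

end

end QTensorModel

/-!
The energy is bounded below uniformly over the densities, since `x ln x ≥ -1`, the field is at most
`1 + |η|` and the sphere has finite area (`le_energy`); so `J > -∞`, and the energy of a density is
finite as soon as the positive part of its integrand is integrable (`energy_lt_top_iff`).

For a density `f` with Q-tensor `Q` the field is `Qp · p - η` (`field_eq_of_mem_admissible`), and
its mean under `f` is `|Q|² - η`. If the energy is finite, `f` vanishes where the field is not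
positive, so that mean is positive (`lt_normSq_of_energy_lt_top`). Moreover great circles have zero
area, so `Qe · e + 1/3 = ∫ (p · e)² f(p) dp > 0` for every unit vector `e`, which says that `Q` is
physical (`mem_physical_of_mem_admissible`).

Conversely let `Q` be physical with eigenvalues `λₖ` and orthonormal eigenvectors `eₖ`. The points
`p = ∑ₖ ±√(λₖ + 1/3) eₖ` lie on the sphere and satisfy `Qp · p = |Q|²`, and four of them
have mean tensor `p ⊗ p - I/3` equal to `Q` (`exists_mem_convexHull_pointTensor`). Suppose
`η < c < |Q|²`. The same construction for the tensors near `Q` shows that `Q` is interior to the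
convex hull of the tensors `p ⊗ p - I/3` with `Qp · p > c`. The Q-tensors of the bounded densities
supported in this open set of points form a convex set whose closure contains that hull, and in
finite dimension a convex set contains every interior point of its closure
(`exists_mem_boundedDensities`). So some bounded density supported in `{Qp · p > c}` has Q-tensor
exactly `Q`, and its energy is finite because its field exceeds `c - η > 0` on its support.

Openness follows from the description of the domain, because by compactness of the sphere the
condition `Qe · e > -1/3` for all unit vectors `e` is open in `Q`.
-/

open MeasureTheory

namespace QTensorModel

/-! ### The surface measure of the sphere -/

theorem surf_eq_zero_iff (s : Set S2) :
    surf s = 0 ↔ μH[2] ((↑) '' s : Set R3) = 0 := by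
  rw [isometry_subtype_coe.hausdorffMeasure_image (Or.inl zero_le_two), surf,
    Measure.euclideanHausdorffMeasure_def, Measure.smul_apply, ENNReal.smul_def, smul_eq_mul,
    mul_eq_zero, ENNReal.coe_eq_zero,
    or_iff_right (Measure.addHaarScalarFactor_volume_hausdorffMeasure_ne_zero 2), Nat.cast_ofNat]

/-- Spherical coordinates. -/
noncomputable def sphericalCoord (x : ℝ × ℝ) : R3 :=
  !₂[Real.sin x.1 * Real.cos x.2, Real.sin x.1 * Real.sin x.2, Real.cos x.1]

theorem contDiff_sphericalCoord : ContDiff ℝ 1 sphericalCoord := by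
  rw [contDiff_euclidean]
  intro i
  fin_cases i <;> simp [sphericalCoord] <;> fun_prop

theorem exists_polar (x y : ℝ) : ∃ t ∈ Set.Icc (-Real.pi) Real.pi,
    x = √(x ^ 2 + y ^ 2) * Real.cos t ∧ y = √(x ^ 2 + y ^ 2) * Real.sin t := by
  have h : ‖(⟨x, y⟩ : ℂ)‖ = √(x ^ 2 + y ^ 2) := by
    rw [Complex.norm_def, Complex.normSq_mk]; ring_nf
  refine ⟨Complex.arg ⟨x, y⟩, ⟨(Complex.neg_pi_lt_arg _).le, Complex.arg_le_pi _⟩, ?_, ?_⟩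
  · rw [← h, Complex.norm_mul_cos_arg]
  · rw [← h, Complex.norm_mul_sin_arg]

theorem sum_sq_eq_one (p : S2) : (p : R3) 0 ^ 2 + (p : R3) 1 ^ 2 + (p : R3) 2 ^ 2 = 1 := by
  have h := EuclideanSpace.real_norm_sq_eq (p : R3)
  rw [norm_eq_of_mem_sphere p, Fin.sum_univ_three] at h
  linarith

theorem range_coe_subset_image_sphericalCoord :
    Set.range ((↑) : S2 → R3) ⊆
      sphericalCoord '' (Set.Icc 0 Real.pi ×ˢ Set.Icc (-Real.pi) Real.pi) := by
  rintro _ ⟨p, rfl⟩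
  have h := sum_sq_eq_one p
  obtain ⟨t, ht, h0, h1⟩ := exists_polar ((p : R3) 0) ((p : R3) 1)
  have hs : √((p : R3) 0 ^ 2 + (p : R3) 1 ^ 2) = Real.sin (Real.arccos ((p : R3) 2)) := by
    rw [Real.sin_arccos]; congr 1; linarith
  refine ⟨(Real.arccos ((p : R3) 2), t), ⟨⟨Real.arccos_nonneg _, Real.arccos_le_pi _⟩, ht⟩, ?_⟩
  rw [hs] at h0 h1
  ext i
  fin_cases i
  · exact h0.symm
  · exact h1.symm
  · exact Real.cos_arccos (by nlinarith) (by nlinarith)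

/-- The sphere is a Lipschitz image of a rectangle, so its area is finite. -/
instance isFiniteMeasure_surf : IsFiniteMeasure surf := by
  constructor
  obtain ⟨K, hK⟩ := contDiff_sphericalCoord.contDiffOn.exists_lipschitzOnWith one_ne_zero
    ((convex_Icc 0 Real.pi).prod (convex_Icc (-Real.pi) Real.pi)) (isCompact_Icc.prod isCompact_Icc)
  have h : μH[2] (Set.univ : Set S2) < ⊤ := by
    rw [← isometry_subtype_coe.hausdorffMeasure_image (Or.inl zero_le_two), Set.image_univ]
    refine (measure_mono range_coe_subset_image_sphericalCoord).trans_lt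
      ((hK.hausdorffMeasure_image_le zero_le_two).trans_lt ?_)
    rw [hausdorffMeasure_prod_real]
    exact ENNReal.mul_lt_top (by simp)
      (isCompact_Icc.prod isCompact_Icc).measure_lt_top
  rw [surf, Measure.euclideanHausdorffMeasure_def, Measure.smul_apply, ENNReal.smul_def,
    smul_eq_mul]
  exact ENNReal.mul_lt_top (by simp) (by simpa using h)

instance fact_finrank_R3 : Fact (Module.finrank ℝ R3 = 2 + 1) := ⟨by simp⟩

/-- Near each of its points the sphere is a graph over the tangent plane, and the orthogonal
projection to that plane does not increase area. -/
instance isOpenPosMeasure_surf : surf.IsOpenPosMeasure := by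
  constructor
  rintro V hV ⟨p, hp⟩ h0
  rw [surf_eq_zero_iff] at h0
  obtain ⟨O, hO, rfl⟩ := isOpen_induced_iff.1 hV
  set F : Submodule ℝ R3 := (ℝ ∙ (p : R3))ᗮ with hF
  have hp1 : ‖(p : R3)‖ = 1 := norm_eq_of_mem_sphere p
  have hfin : Module.finrank ℝ F = 2 := Submodule.finrank_orthogonal_span_singleton
    (ne_zero_of_mem_unit_sphere p)
  have horth (w : F) : inner ℝ (w : R3) (p : R3) = 0 :=
    (Submodule.mem_orthogonal' _ _).1 w.2 _ (Submodule.mem_span_singleton_self _)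
  let g : F → R3 := fun w => (w : R3) + √(1 - ‖w‖ ^ 2) • (p : R3)
  have hg : Continuous g := by fun_prop
  let W : Set F := g ⁻¹' O ∩ Metric.ball 0 1
  have hW : IsOpen W := (hO.preimage hg).inter Metric.isOpen_ball
  have hW0 : (0 : F) ∈ W := ⟨by simpa [g] using hp, by simp⟩
  have hsub : W ⊆ F.orthogonalProjectionOnto '' ((↑) '' ((↑) ⁻¹' O : Set S2)) := by
    rintro w ⟨hwO, hwb⟩
    have hw1 : ‖w‖ < 1 := by simpa using hwb
    have hnorm : ‖g w‖ = 1 := by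
      have : ‖g w‖ ^ 2 = 1 := by
        simp only [g]
        rw [norm_add_sq_real, inner_smul_right, horth, norm_smul, hp1, mul_one, Real.norm_eq_abs,
          sq_abs, Real.sq_sqrt (by nlinarith [norm_nonneg w])]
        simp
      nlinarith [norm_nonneg (g w)]
    refine ⟨g w, ⟨⟨g w, by simpa using hnorm⟩, hwO, rfl⟩, ?_⟩
    have : F.orthogonalProjectionOnto (p : R3) = 0 :=
      Submodule.orthogonalProjectionOnto_orthogonal_apply_eq_zero
        (Submodule.mem_span_singleton_self _)
    simp [g, this]
  have hpos : 0 < μH[2] W := by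
    have : (μH[2] : Measure F).IsAddHaarMeasure := by
      have := MeasureTheory.isAddHaarMeasure_hausdorffMeasure (E := F)
      rw [hfin] at this
      exact_mod_cast this
    exact hW.measure_pos _ ⟨0, hW0⟩
  have hle := (measure_mono hsub).trans
    (F.lipschitzWith_orthogonalProjectionOnto.hausdorffMeasure_image_le zero_le_two _)
  rw [h0, mul_zero] at hle
  exact hpos.not_ge hle

/-- The unit circle of a two-dimensional inner product space has Hausdorff dimension at most
one, being a smooth curve. -/
theorem dimH_sphere_le_one {F : Type*} [NormedAddCommGroup F] [InnerProductSpace ℝ F]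
    (b : OrthonormalBasis (Fin 2) ℝ F) : dimH (Metric.sphere (0 : F) 1) ≤ 1 := by
  let c : ℝ → F := fun t => Real.cos t • b 0 + Real.sin t • b 1
  have hc : ContDiff ℝ 1 c :=
    (Real.contDiff_cos.smul contDiff_const).add (Real.contDiff_sin.smul contDiff_const)
  have hdim : dimH (Set.range c) ≤ 1 := by
    simpa using hc.dimH_range_le
  refine (dimH_mono fun w hw => ?_).trans hdim
  have hw : ‖w‖ = 1 := by simpa using hw
  have hsq : inner ℝ (b 0) w ^ 2 + inner ℝ (b 1) w ^ 2 = 1 := by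
    have := b.sum_sq_norm_inner_right w
    rw [hw, Fin.sum_univ_two] at this
    simpa using this
  obtain ⟨t, -, h0, h1⟩ := exists_polar (inner ℝ (b 0) w) (inner ℝ (b 1) w)
  rw [hsq, Real.sqrt_one, one_mul] at h0 h1
  refine ⟨t, ?_⟩
  have := b.sum_repr' w
  rwa [Fin.sum_univ_two, h0, h1] at this

theorem surf_greatCircle (e : S2) : surf {p | inner ℝ (e : R3) (p : R3) = 0} = 0 := by
  rw [surf_eq_zero_iff]
  have hfin : Module.finrank ℝ (ℝ ∙ (e : R3))ᗮ = 2 :=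
    Submodule.finrank_orthogonal_span_singleton (ne_zero_of_mem_unit_sphere e)
  have hdim : dimH ((↑) '' Metric.sphere (0 : (ℝ ∙ (e : R3))ᗮ) 1 : Set R3) < (2 : NNReal) := by
    rw [isometry_subtype_coe.dimH_image]
    refine (dimH_sphere_le_one
      ((stdOrthonormalBasis ℝ (ℝ ∙ (e : R3))ᗮ).reindex (finCongr hfin))).trans_lt ?_
    norm_num
  have h0 := hausdorffMeasure_of_dimH_lt hdim
  rw [NNReal.coe_ofNat] at h0
  refine measure_mono_null ?_ h0
  rintro _ ⟨p, hp, rfl⟩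
  refine ⟨⟨p, Submodule.mem_orthogonal_singleton_iff_inner_right.2 hp⟩, ?_, rfl⟩
  rw [mem_sphere_zero_iff_norm]
  exact norm_eq_of_mem_sphere p

/-! ### The quadratic form of a Q-tensor -/

/-- The quadratic form `Qp · p`. -/
def quad (Q : Matrix (Fin 3) (Fin 3) ℝ) (p : R3) : ℝ := ∑ i, ∑ j, Q i j * (p i * p j)

theorem inner_eq_sum (p q : R3) : inner ℝ p q = ∑ i, p i * q i := by
  simp [PiLp.inner_apply, mul_comm]

theorem apply_eq_sum_eigenvalues (Q : Sym0) (i j : Fin 3) :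
    (Q : Matrix (Fin 3) (Fin 3) ℝ) i j =
      ∑ k, (Sym0.isHermitian Q).eigenvalues k * ((Sym0.isHermitian Q).eigenvectorBasis k i *
        (Sym0.isHermitian Q).eigenvectorBasis k j) := by
  conv_lhs => rw [(Sym0.isHermitian Q).spectral_theorem]
  rw [Unitary.conjStarAlgAut_apply, Matrix.mul_apply]
  refine Finset.sum_congr rfl fun k _ => ?_
  rw [Matrix.mul_diagonal, Matrix.star_apply]
  simp only [Matrix.IsHermitian.eigenvectorUnitary_apply, Function.comp, star_trivial]
  simp
  ring

theorem one_apply_eq_sum (b : OrthonormalBasis (Fin 3) ℝ R3) (i j : Fin 3) :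
    (1 : Matrix (Fin 3) (Fin 3) ℝ) i j = ∑ k, b k i * b k j := by
  have h := b.sum_inner_mul_inner (EuclideanSpace.single i 1) (EuclideanSpace.single j 1)
  simp only [EuclideanSpace.inner_single_left, EuclideanSpace.inner_single_right] at h
  simp only [map_one, one_mul, PiLp.single_apply] at h
  rw [Matrix.one_apply]
  simpa [eq_comm] using h.symm

theorem quad_eq_sum_eigenvalues (Q : Sym0) (p : R3) :
    quad Q p = ∑ k, (Sym0.isHermitian Q).eigenvalues k *
      (inner ℝ ((Sym0.isHermitian Q).eigenvectorBasis k) p) ^ 2 := by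
  simp only [quad, apply_eq_sum_eigenvalues Q, inner_eq_sum, Fin.sum_univ_three]
  ring

theorem normSq_eq_sum_eigenvalues (Q : Sym0) :
    normSq Q = ∑ k, (Sym0.isHermitian Q).eigenvalues k ^ 2 := by
  have h : normSq Q = ∑ k, (Sym0.isHermitian Q).eigenvalues k *
      quad Q ((Sym0.isHermitian Q).eigenvectorBasis k) := by
    conv_lhs => simp only [normSq, sq]
    conv_lhs => enter [2, i, 2, j, 1]; rw [apply_eq_sum_eigenvalues Q]
    simp only [quad, Fin.sum_univ_three]
    ring
  rw [h]
  refine Finset.sum_congr rfl fun k _ => ?_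
  rw [quad_eq_sum_eigenvalues, Finset.sum_eq_single k]
  · simp; ring
  · intro l _ hl
    rw [OrthonormalBasis.inner_eq_zero _ hl]; simp
  · simp

theorem sum_eigenvalues_eq_zero (Q : Sym0) : ∑ k, (Sym0.isHermitian Q).eigenvalues k = 0 := by
  have h := (Sym0.isHermitian Q).trace_eq_sum_eigenvalues
  rw [Q.2.2] at h
  exact_mod_cast h.symm

theorem mem_physical_iff (Q : Sym0) : Q ∈ physical ↔ ∀ e : S2, -(1 / 3) < quad Q (e : R3) := by
  set b := (Sym0.isHermitian Q).eigenvectorBasis with hb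
  constructor
  · intro h e
    have h1 := b.sum_sq_norm_inner_right (e : R3)
    rw [norm_eq_of_mem_sphere e] at h1
    simp only [Real.norm_eq_abs, sq_abs, one_pow] at h1
    calc -(1 / 3) < vMin Q := h
      _ = ∑ k, vMin Q * inner ℝ (b k) (e : R3) ^ 2 := by rw [← Finset.mul_sum, h1, mul_one]
      _ ≤ quad Q (e : R3) := by
        rw [quad_eq_sum_eigenvalues]
        exact Finset.sum_le_sum fun k _ =>
          mul_le_mul_of_nonneg_right (ciInf_le (Set.finite_range _).bddBelow k) (sq_nonneg _)
  · intro h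
    obtain ⟨k, hk⟩ := exists_eq_ciInf_of_finite (f := (Sym0.isHermitian Q).eigenvalues)
    have h1 := h ⟨b k, by simp⟩
    rw [quad_eq_sum_eigenvalues, Finset.sum_eq_single k] at h1
    · simpa [b, physical, vMin, ← hk] using h1
    · intro l _ hl
      rw [OrthonormalBasis.inner_eq_zero _ hl]; simp
    · simp

theorem continuous_quad : Continuous fun x : Sym0 × R3 => quad x.1 x.2 := by
  unfold quad
  refine continuous_finsetSum _ fun i _ => continuous_finsetSum _ fun j _ => .mul ?_ ?_
  · exact (continuous_subtype_val.comp continuous_fst).matrix_elem i j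
  · fun_prop

theorem continuous_normSq : Continuous normSq := by
  unfold normSq
  exact continuous_finsetSum _ fun i _ => continuous_finsetSum _ fun j _ =>
    (continuous_subtype_val.matrix_elem i j).pow 2

theorem isOpen_physical : IsOpen physical := by
  rw [isOpen_iff_mem_nhds]
  intro Q hQ
  rw [mem_physical_iff] at hQ
  have h : ∀ᶠ Q' : Sym0 in nhds Q, ∀ e ∈ (Set.univ : Set S2), -(1 / 3) < quad Q' (e : R3) := by
    refine isCompact_univ.eventually_forall_of_forall_eventually fun e _ => ?_
    have hc : Continuous fun x : Sym0 × S2 => quad x.1 (x.2 : R3) :=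
      continuous_quad.comp (by fun_prop : Continuous fun x : Sym0 × S2 => (x.1, (x.2 : R3)))
    exact hc.continuousAt.eventually_const_lt (hQ e)
  filter_upwards [h] with Q' hQ'
  exact (mem_physical_iff Q').2 fun e => hQ' e trivial

/-- The Q-tensor `p ⊗ p - I/3` of a point mass at `p`. -/
noncomputable def pointTensor (p : S2) : Sym0 :=
  ⟨Matrix.of fun i j => (p : R3) i * (p : R3) j - (1 / 3) * (1 : Matrix (Fin 3) (Fin 3) ℝ) i j, by
    constructor
    · ext i j
      simp [Matrix.one_apply, mul_comm, eq_comm]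
    · have := sum_sq_eq_one p
      simp [Matrix.trace, Fin.sum_univ_three]
      linarith⟩

theorem pointTensor_apply (p : S2) (i j : Fin 3) :
    (pointTensor p : Matrix (Fin 3) (Fin 3) ℝ) i j =
      (p : R3) i * (p : R3) j - (1 / 3) * (1 : Matrix (Fin 3) (Fin 3) ℝ) i j := rfl

theorem continuous_pointTensor : Continuous pointTensor := by
  refine Continuous.subtype_mk (continuous_matrix fun i j => ?_) _
  simp only [Matrix.of_apply]
  fun_prop

/-- If `Q` has eigenvalues `λₖ` and eigenvectors `eₖ`, the points are `∑ₖ ±√(λₖ + 1/3) eₖ` for the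
four choices of signs with product one: averaging over the signs removes the mixed terms. -/
theorem exists_mem_convexHull_pointTensor {Q : Sym0} (hQ : Q ∈ physical) :
    Q ∈ convexHull ℝ (pointTensor '' {p | quad Q (p : R3) = normSq Q}) := by
  set b := (Sym0.isHermitian Q).eigenvectorBasis with hb
  set l := (Sym0.isHermitian Q).eigenvalues with hl
  have hl0 (k : Fin 3) : 0 ≤ l k + 1 / 3 := by
    have h : -(1 / 3) < vMin Q := hQ
    have h' : vMin Q ≤ l k := ciInf_le (Set.finite_range _).bddBelow k
    linarith
  have hsum : l 0 + l 1 + l 2 = 0 := by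
    rw [← Fin.sum_univ_three]; exact sum_eigenvalues_eq_zero Q
  let v (s : Fin 3 → ℝ) : R3 := ∑ k, (s k * √(l k + 1 / 3)) • b k
  have hinner (s : Fin 3 → ℝ) (k : Fin 3) : inner ℝ (b k) (v s) = s k * √(l k + 1 / 3) :=
    b.orthonormal.inner_right_fintype _ k
  have hinner2 (s : Fin 3 → ℝ) (hs : ∀ k, s k ^ 2 = 1) (k : Fin 3) :
      inner ℝ (b k) (v s) ^ 2 = l k + 1 / 3 := by
    rw [hinner, mul_pow, hs, one_mul, Real.sq_sqrt (hl0 k)]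
  have hnorm (s : Fin 3 → ℝ) (hs : ∀ k, s k ^ 2 = 1) : v s ∈ Metric.sphere (0 : R3) 1 := by
    have h := b.sum_sq_norm_inner_right (v s)
    simp only [Real.norm_eq_abs, sq_abs, hinner2 s hs, Fin.sum_univ_three] at h
    rw [mem_sphere_zero_iff_norm]
    nlinarith [norm_nonneg (v s)]
  have hquad (s : Fin 3 → ℝ) (hs : ∀ k, s k ^ 2 = 1) : quad Q (v s) = normSq Q := by
    rw [quad_eq_sum_eigenvalues, normSq_eq_sum_eigenvalues]
    simp only [← hb, ← hl, hinner2 s hs, Fin.sum_univ_three]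
    linear_combination (1 / 3) * hsum
  let S : Fin 4 → Fin 3 → ℝ := ![![1, 1, 1], ![1, -1, -1], ![-1, 1, -1], ![-1, -1, 1]]
  have hS (m : Fin 4) (k : Fin 3) : S m k ^ 2 = 1 := by
    fin_cases m <;> fin_cases k <;> simp [S]
  have hQ' : Q = ∑ m, (1 / 4 : ℝ) • pointTensor ⟨v (S m), hnorm _ (hS m)⟩ := by
    ext i j
    have hsq (k : Fin 3) : √(l k + 1 / 3) ^ 2 = l k + 1 / 3 := Real.sq_sqrt (hl0 k)
    simp only [Submodule.coe_sum, Submodule.coe_smul, Matrix.sum_apply, Matrix.smul_apply,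
      pointTensor_apply]
    rw [apply_eq_sum_eigenvalues Q, one_apply_eq_sum b]
    simp only [v, S, ← hb, ← hl, Fin.sum_univ_three, Fin.sum_univ_four]
    simp [-one_div]
    linear_combination -(b 0 i * b 0 j) * hsq 0 - (b 1 i * b 1 j) * hsq 1 -
      (b 2 i * b 2 j) * hsq 2
  have hmem (m : Fin 4) : pointTensor ⟨v (S m), hnorm _ (hS m)⟩ ∈
      convexHull ℝ (pointTensor '' {p | quad Q (p : R3) = normSq Q}) :=
    subset_convexHull ℝ _ (Set.mem_image_of_mem _ (hquad _ (hS m)))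
  have h := (convex_convexHull ℝ (pointTensor '' {p | quad Q (p : R3) = normSq Q})).sum_mem
    (t := Finset.univ) (w := fun _ : Fin 4 => (1 / 4 : ℝ)) (fun _ _ => by norm_num)
    (by simp) fun m _ => hmem m
  rwa [← hQ'] at h

/-! ### Moments of bounded densities -/

/-- A convex set of a finite-dimensional space which is dense in a neighbourhood of a point
contains that point. -/
theorem mem_of_closure_mem_nhds {E : Type*} [NormedAddCommGroup E] [NormedSpace ℝ E]
    [FiniteDimensional ℝ E] {K : Set E} (hK : Convex ℝ K) {x : E} (hx : closure K ∈ nhds x) :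
    x ∈ K := by
  have hx' : x ∈ interior (closure K) := mem_interior_iff_mem_nhds.2 hx
  -- The affine span of `K` is closed, so it contains the open set `interior (closure K)`.
  have hspan : affineSpan ℝ K = ⊤ := by
    rw [eq_top_iff, ← isOpen_interior.affineSpan_eq_top ⟨x, hx'⟩, affineSpan_le]
    exact interior_subset.trans
      (closure_minimal (subset_affineSpan ℝ K) (AffineSubspace.closed_of_finiteDimensional _))
  have hint := hK.interior_nonempty_iff_affineSpan_eq_top.2 hspan
  rw [hK.interior_closure_eq_interior_of_nonempty_interior hint] at hx'
  exact interior_subset hx'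

/-- The bounded nonnegative functions of integral one which vanish outside `U`. -/
def boundedDensities {X : Type*} [MeasurableSpace X] (μ : Measure X) (U : Set X) :
    Set (X → ℝ) :=
  {f | Integrable f μ ∧ ∫ p, f p ∂μ = 1 ∧ (∀ p, 0 ≤ f p) ∧ (∃ C, ∀ p, f p ≤ C) ∧
    ∀ p ∉ U, f p = 0}

theorem convex_boundedDensities {X : Type*} [MeasurableSpace X] {μ : Measure X} (U : Set X) :
    Convex ℝ (boundedDensities μ U) := by
  rintro f ⟨hf, hf1, hf0, ⟨C, hC⟩, hfU⟩ g ⟨hg, hg1, hg0, ⟨D, hD⟩, hgU⟩ a b ha hb hab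
  refine ⟨(hf.smul a).add (hg.smul b), ?_, fun p => ?_, ⟨a * C + b * D, fun p => ?_⟩,
    fun p hp => ?_⟩
  · refine (integral_add (hf.smul a) (hg.smul b)).trans ?_
    simp only [Pi.smul_apply, integral_smul, hf1, hg1]
    simpa using hab
  · exact add_nonneg (mul_nonneg ha (hf0 p)) (mul_nonneg hb (hg0 p))
  · exact add_le_add (mul_le_mul_of_nonneg_left (hC p) ha) (mul_le_mul_of_nonneg_left (hD p) hb)
  · simp [hfU p hp, hgU p hp]

section Moments

variable {X : Type*} [TopologicalSpace X] [CompactSpace X] [MeasurableSpace X]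
  [OpensMeasurableSpace X] {μ : Measure X} {E : Type*} [NormedAddCommGroup E] [NormedSpace ℝ E]
  [FiniteDimensional ℝ E] {T : X → E}

theorem integrable_smul_of_continuous {f : X → ℝ} (hf : Integrable f μ) (hT : Continuous T) :
    Integrable (fun p => f p • T p) μ := by
  obtain ⟨C, hC⟩ := isCompact_univ.exists_bound_of_continuousOn hT.continuousOn
  have hm : AEStronglyMeasurable T μ := by
    borelize E
    have := FiniteDimensional.proper ℝ E
    exact hT.measurable.aestronglyMeasurable
  exact hf.smul_bdd C hm (.of_forall fun p => hC p trivial)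

theorem convex_moments (hT : Continuous T) (U : Set X) :
    Convex ℝ ((fun f : X → ℝ => ∫ p, f p • T p ∂μ) '' boundedDensities μ U) := by
  rintro _ ⟨f, hf, rfl⟩ _ ⟨g, hg, rfl⟩ a b ha hb hab
  refine ⟨a • f + b • g, convex_boundedDensities U hf hg ha hb hab, ?_⟩
  simp only [Pi.add_apply, Pi.smul_apply, add_smul, smul_assoc]
  rw [integral_add, integral_smul, integral_smul]
  · exact (integrable_smul_of_continuous hf.1 hT).smul a
  · exact (integrable_smul_of_continuous hg.1 hT).smul b

/-- The normalised indicator function of a small neighbourhood of a point approximates the point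
mass. -/
theorem mem_closure_moments [IsFiniteMeasure μ] [μ.IsOpenPosMeasure] (hT : Continuous T)
    {U : Set X} (hU : IsOpen U) {p : X} (hp : p ∈ U) :
    T p ∈ closure ((fun f : X → ℝ => ∫ p, f p • T p ∂μ) '' boundedDensities μ U) := by
  have := FiniteDimensional.complete ℝ E
  rw [mem_closure_iff_nhds_basis Metric.nhds_basis_closedBall]
  intro ε hε
  let V : Set X := T ⁻¹' Metric.ball (T p) ε ∩ U
  have hV : IsOpen V := (Metric.isOpen_ball.preimage hT).inter hU
  have hpos : μ V ≠ 0 := (hV.measure_pos μ ⟨p, by simpa using hε, hp⟩).ne'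
  have hpos' : 0 < μ.real V := ENNReal.toReal_pos hpos (measure_ne_top μ V)
  have h1 : Integrable (V.indicator fun _ => (μ.real V)⁻¹) μ :=
    (integrable_const _).indicator hV.measurableSet
  refine ⟨_, ⟨V.indicator fun _ => (μ.real V)⁻¹, ⟨h1, ?_, fun q => ?_, ⟨(μ.real V)⁻¹, fun q => ?_⟩,
    fun q hq => ?_⟩, rfl⟩, ?_⟩
  · rw [integral_indicator hV.measurableSet, setIntegral_const, smul_eq_mul,
      mul_inv_cancel₀ hpos'.ne']
  · exact Set.indicator_nonneg (fun _ _ => (inv_pos.2 hpos').le) q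
  · exact Set.indicator_le_self' (fun _ _ => (inv_pos.2 hpos').le) q
  · exact Set.indicator_of_notMem (fun h => hq h.2) _
  · have hTint : Integrable T μ := by
      simpa using integrable_smul_of_continuous (integrable_const (μ := μ) (1 : ℝ)) hT
    have h2 := (convex_closedBall (T p) ε).set_average_mem Metric.isClosed_closedBall hpos
      (measure_ne_top μ V) (ae_restrict_of_forall_mem hV.measurableSet fun q hq =>
        Metric.ball_subset_closedBall hq.1) hTint.integrableOn
    rw [setAverage_eq, ← integral_smul, ← integral_indicator hV.measurableSet] at h2
    convert h2 using 3 with q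
    by_cases hq : q ∈ V <;> simp [hq]

/-- A point with a neighbourhood in the convex hull of the values of `T` on an open set `U` is the
mean of `T` for a bounded density supported in `U`. -/
theorem exists_mem_boundedDensities [IsFiniteMeasure μ] [μ.IsOpenPosMeasure] (hT : Continuous T)
    {U : Set X} (hU : IsOpen U) {x : E} (hx : convexHull ℝ (T '' U) ∈ nhds x) :
    ∃ f ∈ boundedDensities μ U, ∫ p, f p • T p ∂μ = x := by
  refine mem_of_closure_mem_nhds (convex_moments hT U) (Filter.mem_of_superset hx ?_)
  refine convexHull_min ?_ (convex_moments hT U).closure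
  rintro _ ⟨p, hp, rfl⟩
  exact mem_closure_moments hT hU hp

end Moments

/-! ### The Q-tensor and the field of a density -/

theorem integrable_mul_of_continuous {f φ : S2 → ℝ} (hf : Integrable f surf)
    (hφ : Continuous φ) : Integrable (fun p => φ p * f p) surf := by
  simpa [mul_comm] using integrable_smul_of_continuous hf hφ

theorem continuous_pointTensor_apply (i j : Fin 3) :
    Continuous fun p => (pointTensor p : Matrix (Fin 3) (Fin 3) ℝ) i j :=
  (continuous_subtype_val.comp continuous_pointTensor).matrix_elem i j

theorem qTensor_apply (f : S2 → ℝ) (i j : Fin 3) :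
    qTensor f i j = ∫ p, (pointTensor p : Matrix (Fin 3) (Fin 3) ℝ) i j * f p ∂surf := rfl

theorem quad_pointTensor (p q : S2) :
    quad (pointTensor q) (p : R3) = inner ℝ (p : R3) (q : R3) ^ 2 - 1 / 3 := by
  have h := sum_sq_eq_one p
  simp [quad, pointTensor_apply, inner_eq_sum, Fin.sum_univ_three, Matrix.one_apply]
  linear_combination (-1 / 3) * h

theorem quad_qTensor {f : S2 → ℝ} (hf : Integrable f surf) (p : S2) :
    quad (qTensor f) (p : R3) =
      ∫ q : S2, (inner ℝ (p : R3) (q : R3) ^ 2 - 1 / 3) * f q ∂surf := by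
  have hi (i j : Fin 3) := (integrable_mul_of_continuous hf
    (continuous_pointTensor_apply i j)).mul_const ((p : R3) i * (p : R3) j)
  simp_rw [← quad_pointTensor, quad, qTensor_apply, Finset.sum_mul]
  rw [integral_finsetSum]
  · refine Finset.sum_congr rfl fun i _ => ?_
    rw [integral_finsetSum]
    · refine Finset.sum_congr rfl fun j _ => ?_
      rw [← integral_mul_const]
      exact integral_congr_ae (.of_forall fun q => by ring)
    · intro j _
      exact (hi i j).congr (.of_forall fun q => by ring)
  · intro i _
    exact integrable_finsetSum _ fun j _ => (hi i j).congr (.of_forall fun q => by ring)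

theorem field_eq_quad (η : ℝ) {f : S2 → ℝ} (hf : Integrable f surf) (p : S2) :
    field η f p = quad (qTensor f) (p : R3) - η := by
  rw [quad_qTensor hf, field]

theorem quad_eq_sum_pointTensor (Q : Sym0) (p : S2) :
    quad Q (p : R3) = ∑ i, ∑ j, (Q : Matrix (Fin 3) (Fin 3) ℝ) i j *
      (pointTensor p : Matrix (Fin 3) (Fin 3) ℝ) i j := by
  have h : (Q : Matrix (Fin 3) (Fin 3) ℝ).trace = 0 := Q.2.2
  simp only [Matrix.trace, Matrix.diag_apply, Fin.sum_univ_three] at h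
  simp [quad, pointTensor_apply, Fin.sum_univ_three, Matrix.one_apply]
  linear_combination (1 / 3) * h

/-- Pairing the identity for the Q-tensor of `f` with `Q` itself. -/
theorem integral_quad_mul {Q : Sym0} {f : S2 → ℝ} (hf : f ∈ admissible Q) :
    ∫ p : S2, quad Q (p : R3) * f p ∂surf = normSq Q := by
  have hi (i j : Fin 3) := (integrable_mul_of_continuous hf.1.1
    (continuous_pointTensor_apply i j)).const_mul ((Q : Matrix (Fin 3) (Fin 3) ℝ) i j)
  simp_rw [quad_eq_sum_pointTensor, normSq, Finset.sum_mul, mul_assoc]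
  rw [integral_finsetSum _ fun i _ => integrable_finsetSum _ fun j _ => hi i j]
  refine Finset.sum_congr rfl fun i _ => ?_
  rw [integral_finsetSum _ fun j _ => hi i j]
  refine Finset.sum_congr rfl fun j _ => ?_
  rw [integral_const_mul, ← qTensor_apply, hf.2, sq]

theorem continuous_quad_coe (Q : Sym0) : Continuous fun p : S2 => quad Q (p : R3) :=
  continuous_quad.comp (by fun_prop : Continuous fun p : S2 => (Q, (p : R3)))

/-- A density is not concentrated on a great circle, so its second moment in every direction is
positive. -/
theorem mem_physical_of_mem_admissible {Q : Sym0} {f : S2 → ℝ} (hf : f ∈ admissible Q) :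
    Q ∈ physical := by
  rw [mem_physical_iff]
  intro e
  obtain ⟨⟨hfi, hf0, hf1⟩, hfQ⟩ := hf
  have hint : Integrable (fun q : S2 => inner ℝ (e : R3) (q : R3) ^ 2 * f q) surf :=
    integrable_mul_of_continuous hfi (by fun_prop)
  have hnonneg : 0 ≤ᵐ[surf] fun q : S2 => inner ℝ (e : R3) (q : R3) ^ 2 * f q := by
    filter_upwards [hf0] with q hq using mul_nonneg (sq_nonneg _) hq
  have hpos : 0 < ∫ q : S2, inner ℝ (e : R3) (q : R3) ^ 2 * f q ∂surf := by
    refine (integral_nonneg_of_ae hnonneg).lt_of_ne fun h => ?_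
    have hf_zero : f =ᵐ[surf] 0 := by
      filter_upwards [(integral_eq_zero_iff_of_nonneg_ae hnonneg hint).1 h.symm,
        measure_eq_zero_iff_ae_notMem.1 (surf_greatCircle e)] with q hq hqe
      exact (mul_eq_zero.1 hq).resolve_left (pow_ne_zero 2 hqe)
    rw [integral_congr_ae hf_zero] at hf1
    simp at hf1
  rw [← hfQ, quad_qTensor hfi]
  simp_rw [sub_mul]
  rw [integral_sub hint (hfi.const_mul _), integral_const_mul, hf1]
  linarith

/-- The physical Q-tensors near `Q` are all convex combinations of point tensors `p ⊗ p - I/3`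
with `Qp · p > c`, for every `c < |Q|²`. -/
theorem exists_boundedDensities_admissible {Q : Sym0} (hQ : Q ∈ physical) {c : ℝ}
    (hc : c < normSq Q) :
    ∃ f ∈ boundedDensities surf {p : S2 | c < quad Q (p : R3)}, f ∈ admissible Q := by
  have hnhds : convexHull ℝ (pointTensor '' {p : S2 | c < quad Q (p : R3)}) ∈ nhds Q := by
    have h1 : ∀ᶠ Q' : Sym0 in nhds Q, ∀ p ∈ (Set.univ : Set S2),
        c < normSq Q' + (quad Q (p : R3) - quad Q' (p : R3)) := by
      refine isCompact_univ.eventually_forall_of_forall_eventually fun p _ => ?_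
      have hcont : Continuous fun x : Sym0 × S2 =>
          normSq x.1 + (quad Q (x.2 : R3) - quad x.1 (x.2 : R3)) :=
        (continuous_normSq.comp continuous_fst).add
          (((continuous_quad_coe Q).comp continuous_snd).sub (continuous_quad.comp
            (by fun_prop : Continuous fun x : Sym0 × S2 => (x.1, (x.2 : R3)))))
      exact hcont.continuousAt.eventually_const_lt (by simpa using hc)
    filter_upwards [h1, isOpen_physical.mem_nhds hQ] with Q' h1 h2
    refine convexHull_mono (Set.image_mono fun p hp => ?_) (exists_mem_convexHull_pointTensor h2)
    have h3 := h1 p trivial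
    rw [Set.mem_ofPred_eq] at hp ⊢
    linarith
  -- The norm is only needed to speak of integrals with values in `Sym0`.
  let : NormedAddCommGroup (Matrix (Fin 3) (Fin 3) ℝ) := Matrix.normedAddCommGroup
  let : NormedSpace ℝ (Matrix (Fin 3) (Fin 3) ℝ) := Matrix.normedSpace
  obtain ⟨f, hf, hfQ⟩ := exists_mem_boundedDensities (E := Sym0) (μ := surf)
    continuous_pointTensor (isOpen_lt continuous_const (continuous_quad_coe Q)) hnhds
  refine ⟨f, hf, ⟨hf.1, .of_forall hf.2.2.1, hf.2.1⟩, ?_⟩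
  ext i j
  let L : Sym0 →L[ℝ] ℝ := LinearMap.toContinuousLinearMap
    ((Matrix.entryLinearMap ℝ ℝ i j).comp Sym0.subtype)
  have h := L.integral_comp_comm (integrable_smul_of_continuous hf.1 continuous_pointTensor)
  rw [hfQ] at h
  rw [qTensor_apply]
  refine Eq.trans ?_ h
  refine integral_congr_ae (.of_forall fun p => ?_)
  exact mul_comm _ _

/-! ### The energy -/

/-- The integrand of the free energy. -/
noncomputable def integrand (η : ℝ) (f : S2 → ℝ) (p : S2) : EReal :=
  ((f p * Real.log (f p) : ℝ) : EReal) + ((f p : ℝ) : EReal) * negLog (field η f p)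

theorem energy_eq (η : ℝ) (f : S2 → ℝ) :
    energy η f = ((∫⁻ p, (integrand η f p).toENNReal ∂surf : ENNReal) : EReal) -
      ((∫⁻ p, (-integrand η f p).toENNReal ∂surf : ENNReal) : EReal) := rfl

theorem integrand_of_zero {η : ℝ} {f : S2 → ℝ} {p : S2} (hf : f p = 0) :
    integrand η f p = 0 := by
  simp [integrand, hf]

theorem integrand_of_field_pos {η : ℝ} {f : S2 → ℝ} {p : S2} (h : 0 < field η f p) :
    integrand η f p = ((f p * Real.log (f p) - f p * Real.log (field η f p) : ℝ) : EReal) := by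
  rw [integrand, negLog, if_pos h, ← EReal.coe_mul, ← EReal.coe_add]
  ring_nf

theorem integrand_of_field_nonpos {η : ℝ} {f : S2 → ℝ} {p : S2} (h : field η f p ≤ 0)
    (hf : 0 < f p) : integrand η f p = ⊤ := by
  rw [integrand, negLog, if_neg h.not_gt, EReal.coe_mul_top_of_pos hf, EReal.coe_add_top]

theorem field_le (η : ℝ) {f : S2 → ℝ} (hf : f ∈ densities) (p : S2) : field η f p ≤ 1 + |η| := by
  have h : ∫ q : S2, (inner ℝ (p : R3) (q : R3) ^ 2 - 1 / 3) * f q ∂surf ≤ ∫ q, f q ∂surf := by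
    refine integral_mono_ae (integrable_mul_of_continuous hf.1 (by fun_prop)) hf.1 ?_
    filter_upwards [hf.2.1] with q hq
    have h1 := abs_real_inner_le_norm (p : R3) (q : R3)
    rw [norm_eq_of_mem_sphere p, norm_eq_of_mem_sphere q, one_mul] at h1
    have h2 := (sq_le_one_iff_abs_le_one _).2 h1
    exact mul_le_of_le_one_left hq (by linarith)
  rw [hf.2.2] at h
  rw [field]
  linarith [neg_abs_le η]

theorem neg_one_le_mul_log {x : ℝ} (hx : 0 < x) : -1 ≤ x * Real.log x := by
  have h := mul_le_mul_of_nonneg_left (Real.one_sub_inv_le_log_of_pos hx) hx.le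
  rw [mul_sub, mul_inv_cancel₀ hx.ne'] at h
  linarith

/-- The entropy density is bounded below and the field is bounded above, so the negative part of
the energy is bounded uniformly in the density. -/
theorem lintegral_neg_integrand_le (η : ℝ) {f : S2 → ℝ} (hf : f ∈ densities) :
    ∫⁻ p, (-integrand η f p).toENNReal ∂surf ≤
      ENNReal.ofReal (surf.real Set.univ + Real.log (1 + |η|)) := by
  have hM : 0 ≤ Real.log (1 + |η|) := Real.log_nonneg (by linarith [abs_nonneg η])
  have h0 : 0 ≤ᵐ[surf] fun p => 1 + Real.log (1 + |η|) * f p := by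
    filter_upwards [hf.2.1] with p hp
    have := mul_nonneg hM hp
    exact add_nonneg zero_le_one this
  have hint : Integrable (fun p => 1 + Real.log (1 + |η|) * f p) surf :=
    (integrable_const _).add (hf.1.const_mul _)
  have heq : ∫ p, 1 + Real.log (1 + |η|) * f p ∂surf =
      surf.real Set.univ + Real.log (1 + |η|) := by
    rw [integral_add (integrable_const _) (hf.1.const_mul _), integral_const_mul, hf.2.2]
    simp
  rw [← heq, ofReal_integral_eq_lintegral_ofReal hint h0]
  refine lintegral_mono_ae ?_
  filter_upwards [hf.2.1] with p hp
  have hp : 0 ≤ f p := hp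
  rcases hp.eq_or_lt with h | h
  · simp [integrand_of_zero h.symm]
  rcases le_or_gt (field η f p) 0 with hneg | hpos
  · simp [integrand_of_field_nonpos hneg h]
  rw [integrand_of_field_pos hpos, ← EReal.coe_neg, EReal.real_coe_toENNReal]
  refine ENNReal.ofReal_le_ofReal ?_
  have h1 := mul_le_mul_of_nonneg_left (Real.log_le_log hpos (field_le η hf p)) hp
  linarith [neg_one_le_mul_log h]

/-- The free energy is bounded below, uniformly over the densities. -/
theorem le_energy (η : ℝ) {f : S2 → ℝ} (hf : f ∈ densities) :
    ((-(surf.real Set.univ + Real.log (1 + |η|)) : ℝ) : EReal) ≤ energy η f := by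
  have hM : 0 ≤ surf.real Set.univ + Real.log (1 + |η|) :=
    add_nonneg measureReal_nonneg (Real.log_nonneg (by linarith [abs_nonneg η]))
  rw [energy_eq, EReal.coe_neg, ← zero_sub]
  refine EReal.sub_le_sub (EReal.coe_ennreal_nonneg _) ?_
  refine (EReal.coe_ennreal_le_coe_ennreal_iff.2 (lintegral_neg_integrand_le η hf)).trans ?_
  rw [EReal.coe_ennreal_ofReal, max_eq_left hM]

theorem energy_lt_top_iff (η : ℝ) {f : S2 → ℝ} (hf : f ∈ densities) :
    energy η f < ⊤ ↔ ∫⁻ p, (integrand η f p).toENNReal ∂surf < ⊤ := by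
  have hB : ∫⁻ p, (-integrand η f p).toENNReal ∂surf ≠ ⊤ :=
    ((lintegral_neg_integrand_le η hf).trans_lt ENNReal.ofReal_lt_top).ne
  rw [energy_eq]
  lift ∫⁻ p, (-integrand η f p).toENNReal ∂surf to NNReal using hB with B
  rcases eq_or_ne (∫⁻ p, (integrand η f p).toENNReal ∂surf) ⊤ with hA | hA
  · rw [hA]
    simp
  · lift ∫⁻ p, (integrand η f p).toENNReal ∂surf to NNReal using hA with A
    rw [EReal.coe_nnreal_eq_coe_real, EReal.coe_nnreal_eq_coe_real, ← EReal.coe_sub]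
    exact iff_of_true (EReal.coe_lt_top _) ENNReal.coe_lt_top

theorem field_eq_of_mem_admissible (η : ℝ) {Q : Sym0} {f : S2 → ℝ} (hf : f ∈ admissible Q)
    (p : S2) : field η f p = quad Q (p : R3) - η := by
  rw [field_eq_quad η hf.1.1, hf.2]

theorem continuous_field (η : ℝ) {Q : Sym0} {f : S2 → ℝ} (hf : f ∈ admissible Q) :
    Continuous (field η f) := by
  rw [funext (field_eq_of_mem_admissible η hf)]
  exact (continuous_quad_coe Q).sub continuous_const

/-- A density of finite energy vanishes where the field is not positive. -/
theorem ae_field_pos_of_energy_lt_top {η : ℝ} {Q : Sym0} {f : S2 → ℝ} (hf : f ∈ admissible Q)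
    (h : energy η f < ⊤) : ∀ᵐ p ∂surf, field η f p ≤ 0 → f p = 0 := by
  rw [energy_lt_top_iff η hf.1] at h
  have hN : MeasurableSet {p : S2 | field η f p ≤ 0} :=
    (isClosed_le (continuous_field η hf) continuous_const).measurableSet
  have hm : AEMeasurable (fun p => ⊤ * ENNReal.ofReal (f p)) surf :=
    hf.1.1.aemeasurable.ennreal_ofReal.const_mul _
  have hle : ∫⁻ p, {p : S2 | field η f p ≤ 0}.indicator
      (fun p => ⊤ * ENNReal.ofReal (f p)) p ∂surf < ⊤ := by
    refine (lintegral_mono_ae ?_).trans_lt h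
    filter_upwards [hf.1.2.1] with p hp
    have hp : 0 ≤ f p := hp
    refine Set.indicator_apply_le' (fun hpN => ?_) fun _ => zero_le
    rcases hp.eq_or_lt with h0 | h0
    · simp [← h0]
    · simp [integrand_of_field_nonpos hpN h0]
  filter_upwards [ae_lt_top' (hm.indicator hN) hle.ne, hf.1.2.1] with p hp h0 hpN
  rw [Set.indicator_of_mem (show p ∈ {p : S2 | field η f p ≤ 0} from hpN)] at hp
  by_contra hne
  have hpos : 0 < f p := lt_of_le_of_ne h0 (Ne.symm hne)
  rw [ENNReal.top_mul (by simpa using hpos)] at hp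
  exact hp.ne rfl

/-- The mean of the field `Qp · p - η` under the density is `|Q|² - η`. -/
theorem lt_normSq_of_energy_lt_top {η : ℝ} {Q : Sym0} {f : S2 → ℝ} (hf : f ∈ admissible Q)
    (h : energy η f < ⊤) : η < normSq Q := by
  have hfield := ae_field_pos_of_energy_lt_top hf h
  have hint : Integrable (fun p => field η f p * f p) surf :=
    integrable_mul_of_continuous hf.1.1 (continuous_field η hf)
  have hnonneg : 0 ≤ᵐ[surf] fun p => field η f p * f p := by
    filter_upwards [hfield, hf.1.2.1] with p hp h0
    rcases le_or_gt (field η f p) 0 with hle | hgt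
    · simp [hp hle]
    · exact mul_nonneg hgt.le h0
  have hmean : ∫ p, field η f p * f p ∂surf = normSq Q - η := by
    simp_rw [field_eq_of_mem_admissible η hf, sub_mul]
    rw [integral_sub (integrable_mul_of_continuous hf.1.1 (continuous_quad_coe Q))
      (hf.1.1.const_mul η), integral_quad_mul hf, integral_const_mul, hf.1.2.2, mul_one]
  rw [← sub_pos, ← hmean]
  refine (integral_nonneg_of_ae hnonneg).lt_of_ne fun h0 => ?_
  have hf_zero : f =ᵐ[surf] 0 := by
    filter_upwards [(integral_eq_zero_iff_of_nonneg_ae hnonneg hint).1 h0.symm, hfield] with p hp h1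
    rcases mul_eq_zero.1 hp with h2 | h2
    · exact h1 h2.le
    · exact h2
  have hf1 := hf.1.2.2
  rw [integral_congr_ae hf_zero] at hf1
  simp at hf1

/-- The energy is finite for a bounded density whose field is bounded away from zero on its
support. -/
theorem energy_lt_top_of_mem_boundedDensities {η c : ℝ} (hηc : η < c) {Q : Sym0} {f : S2 → ℝ}
    (hf : f ∈ boundedDensities surf {p : S2 | c < quad Q (p : R3)}) (hQ : f ∈ admissible Q) :
    energy η f < ⊤ := by
  obtain ⟨-, -, h0, ⟨C, hC⟩, hU⟩ := hf
  rw [energy_lt_top_iff η hQ.1]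
  have hle (p : S2) : (integrand η f p).toENNReal ≤
      ENNReal.ofReal (C * (C + |Real.log (c - η)|)) := by
    rcases (h0 p).eq_or_lt with h | h
    · simp [integrand_of_zero h.symm]
    have hp : c < quad Q (p : R3) := by
      by_contra hp
      exact h.ne' (hU p hp)
    have hfield : c - η < field η f p := by
      rw [field_eq_of_mem_admissible η hQ]
      linarith
    have hpos : 0 < field η f p := (sub_pos.2 hηc).trans hfield
    rw [integrand_of_field_pos hpos, EReal.real_coe_toENNReal, ← mul_sub]
    refine ENNReal.ofReal_le_ofReal ?_
    have h1 := Real.log_le_log (sub_pos.2 hηc) hfield.le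
    have h2 := Real.log_le_sub_one_of_pos h
    have h3 := neg_abs_le (Real.log (c - η))
    have h4 := hC p
    calc f p * (Real.log (f p) - Real.log (field η f p))
        ≤ f p * (C + |Real.log (c - η)|) := mul_le_mul_of_nonneg_left (by linarith) h.le
      _ ≤ C * (C + |Real.log (c - η)|) :=
        mul_le_mul_of_nonneg_right h4 (add_nonneg (h.le.trans h4) (abs_nonneg _))
  refine (lintegral_mono hle).trans_lt ?_
  rw [lintegral_const]
  exact ENNReal.mul_lt_top ENNReal.ofReal_lt_top (measure_lt_top _ _)

/-! ### The effective domain -/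

theorem J_ne_bot (η : ℝ) (Q : Sym0) : J η Q ≠ ⊥ :=
  ((EReal.bot_lt_coe _).trans_le (le_iInf₂ fun _ hf => le_energy η hf.1)).ne'

theorem domJ_eq (η : ℝ) : domJ η = physical ∩ {Q | η < normSq Q} := by
  ext Q
  constructor
  · intro h
    have h : J η Q < ⊤ := h
    simp only [J, iInf_lt_iff] at h
    obtain ⟨f, hf, hlt⟩ := h
    exact ⟨mem_physical_of_mem_admissible hf, lt_normSq_of_energy_lt_top hf hlt⟩
  · rintro ⟨hQ, hη⟩
    obtain ⟨c, hηc, hc⟩ := exists_between (show η < normSq Q from hη)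
    obtain ⟨f, hf, hfQ⟩ := exists_boundedDensities_admissible hQ hc
    have hJ : J η Q ≤ energy η f := iInf₂_le f hfQ
    exact hJ.trans_lt (energy_lt_top_of_mem_boundedDensities hηc hf hfQ)

end QTensorModel

theorem mainTheorem5 (η : ℝ) :
    (∀ Q : QTensorModel.Sym0, QTensorModel.J η Q ≠ ⊥) ∧
    QTensorModel.domJ η =
      QTensorModel.physical ∩ {Q : QTensorModel.Sym0 | η < QTensorModel.normSq Q} ∧
    IsOpen (QTensorModel.domJ η) := by
  refine ⟨QTensorModel.J_ne_bot η, QTensorModel.domJ_eq η, ?_⟩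
  rw [QTensorModel.domJ_eq]
  exact QTensorModel.isOpen_physical.inter
    (isOpen_lt continuous_const QTensorModel.continuous_normSq)
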